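/- Let $H_1,H_2$ be complex Hilbert spaces and let $J_i=J_i^*=J_i^{-1}$ be a bounded operator on $H_i$ ($i=1,2$), so that $(H_i,J_i)$ is a Krein space with the indefinite inner product $[f,g]=(J_if,g)$. Let $J=\begin{pmatrix}J_1&0\\0&J_2\end{pmatrix}$ on $H_1\oplus H_2$. For a bounded operator $T:(H,J_H)\to(K,J_K)$ between Krein spaces let $T^{[*]}=J_HT^*J_K$ be its Krein space adjoint. For a bounded $A=A^{[*]}$ on $(H,J_H)$ let $\nu_-[A]\in\{0,1,\dots\}\cup\{\infty\}$ be the number of negative squares of the form $[Af,f]$, i.e. the supremum of the dimensions of the finite-dimensional subspaces of $H$ on which this form is negative definite. For bounded selfadjoint operators $A,B$ on $(H,J_H)$ write $A\ge_{J_H}B$ if $[(A-B)f,f]\ge0$ for all $f\in H$. Put $|C|=(C^*C)^{1/2}$, and for a selfadjoint operator $D$ on a Hilbert space with spectral family $(E_t)$ put $\operatorname{sign}(D)=\int_{\mathbb R}\operatorname{sign}(t)\,dE_t$, where $\operatorname{sign}(t)=1$ for $t\ge0$ and $\operatorname{sign}(t)=-1$ for $t<0$. **Theorem.** Let $$A^0=\begin{pmatrix}A_{11}&A_{12}\\A_{21}&*\end{pmatrix}$$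 be an incomplete block operator in the Krein space $(H_1\oplus H_2,J)$ with bounded entries, $A_{11}=A_{11}^{[*]}$ and $A_{21}=A_{12}^{[*]}$. Assume that $\nu_-[A_{11}]=\kappa<\infty$, and let $J_{11}=\operatorname{sign}(J_1A_{11})$. Let $\mathcal A$ be the set of all bounded operators $A_{22}=A_{22}^{[*]}$ on $(H_2,J_2)$ for which the completion $A=(A_{ij})_{i,j=1}^2$ satisfies $\nu_-[A]=\kappa$. (i) There exists a completion $A$ of $A^0$ with some bounded $A_{22}=A_{22}^{[*]}$ such that $\nu_-[A]=\nu_-[A_{11}]=\kappa$ (that is, $\mathcal A\neq\emptyset$) if and only if $$\operatorname{ran}J_1A_{12}\subset\operatorname{ran}|A_{11}|^{1/2}.$$ (ii) In this case the operator $S=|A_{11}|^{[-1/2]}J_1A_{12}$, where $|A_{11}|^{[-1/2]}$ is the (possibly unbounded) Moore–Penrose inverse of $|A_{11}|^{1/2}$, is well defined on all of $H_2$ and is a bounded operator from $H_2$ to $H_1$. Moreover, $S^{[*]}J_1J_{11}S$ belongs to $\mathcal A$ and is its smallest element with respect to the order $\ge_{J_2}$, and $$\mathcal A=\{A_{22}:\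 A_{22}=J_2(S^*J_{11}S+Y)=S^{[*]}J_1J_{11}S+J_2Y,\ Y \text{ bounded on } H_2,\ Y=Y^*\ge0\}.$$ -/

import Mathlib

noncomputable section

namespace Krein

variable {E F : Type*}
  [NormedAddCommGroup E] [InnerProductSpace ℂ E] [CompleteSpace E]
  [NormedAddCommGroup F] [InnerProductSpace ℂ F] [CompleteSpace F]

/-- `J = J* = J⁻¹`: the pair `(E, J)` is then a Krein space with fundamental symmetry `J`. -/
def IsFundamentalSymmetry (J : E →L[ℂ] E) : Prop :=
  ContinuousLinearMap.adjoint J = J ∧ J ∘L J = ContinuousLinearMap.id ℂ E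

/-- The indefinite scalar product `[f, g] = (J f, g)`, linear in `f`. (Mathlib's `inner` is linear
in its second argument, so the Hilbert scalar product `(x, y)` is `inner ℂ y x`.) -/
def form (J : E →L[ℂ] E) (f g : E) : ℂ := inner ℂ g (J f)

/-- The Krein space adjoint `T^[*] = J_E T* J_F` of a bounded operator
`T : (E, J_E) → (F, J_F)`. -/
def kreinAdjoint (JE : E →L[ℂ] E) (JF : F →L[ℂ] F) (T : E →L[ℂ] F) : F →L[ℂ] E :=
  JE ∘L ContinuousLinearMap.adjoint T ∘L JF

/-- The defining property of the Krein space adjoint: `[T x, y] = [x, T^[*] y]`. -/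
theorem form_kreinAdjoint {JE : E →L[ℂ] E} {JF : F →L[ℂ] F}
    (hE : IsFundamentalSymmetry JE) (hF : IsFundamentalSymmetry JF)
    (T : E →L[ℂ] F) (x : E) (y : F) :
    form JF (T x) y = form JE x (kreinAdjoint JE JF T y) := by
  have h2 : JE (JE x) = x := by
    have h := congrArg (fun L : E →L[ℂ] E => L x) hE.2
    simpa using h
  have h3 : ∀ a b : E, inner ℂ (JE a) b = inner ℂ a (JE b) := by
    intro a b
    rw [← ContinuousLinearMap.adjoint_inner_right, hE.1]
  have h4 : ∀ a b : F, inner ℂ (JF a) b = inner ℂ a (JF b) := by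
    intro a b
    rw [← ContinuousLinearMap.adjoint_inner_right, hF.1]
  simp only [form, kreinAdjoint, ContinuousLinearMap.comp_apply]
  rw [h3, h2, ContinuousLinearMap.adjoint_inner_left, h4]

/-- Selfadjointness in the Krein space `(E, J)`: `T = T^[*]`. -/
def IsKreinSelfAdjoint (J : E →L[ℂ] E) (T : E →L[ℂ] E) : Prop :=
  T = kreinAdjoint J J T

/-- The number of negative squares of a (quadratic) form `q` on `E`: the supremum of the
dimensions of the finite-dimensional subspaces on which `q` is negative definite. -/
def negSquares (q : E → ℝ) : ℕ∞ :=
  ⨆ (L : Submodule ℂ E) (_ : FiniteDimensional ℂ L) (_ : ∀ f ∈ L, f ≠ 0 → q f < 0),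
    (Module.finrank ℂ L : ℕ∞)

/-- `ν₋[A]`: the number of negative squares of the quadratic form `[A f, f]` (which is real when
`A` is selfadjoint in `(E, J)`). -/
def negIndex (J : E →L[ℂ] E) (A : E →L[ℂ] E) : ℕ∞ :=
  negSquares (fun f : E => (form J (A f) f).re)

/-- The order `A ≥_J B` of selfadjoint operators in `(E, J)`: `[(A - B) f, f] ≥ 0` for all `f`. -/
def KreinLE (J : E →L[ℂ] E) (B A : E →L[ℂ] E) : Prop :=
  ∀ f : E, 0 ≤ (form J ((A - B) f) f).re

/-- `|C|^{1/2}`, where `|C| = (C* C)^{1/2}` is the Hilbert space modulus. -/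
def sqrtModulus (C : E →L[ℂ] E) : E →L[ℂ] E := CFC.sqrt (CFC.abs C)

/-- `sign(H) = ∫ sign(t) dE_t` for a selfadjoint `H` in a Hilbert space, where `sign(t) = 1` for
`t ≥ 0` and `sign(t) = -1` for `t < 0`. The kernel of the negative part `H⁻` is the spectral
subspace of `H` for `[0, ∞)`, and its orthogonal complement the one for `(-∞, 0)`; so `sign(H)`
is the identity on the former and minus the identity on the latter. -/
def signOp (H : E →L[ℂ] E) : E →L[ℂ] E :=
  ((LinearMap.ker ((H⁻ : E →L[ℂ] E) : E →ₗ[ℂ] E)).reflection : E →L[ℂ] E)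

/-- The graph of the Moore-Penrose inverse of `R : E → F`: the pairs `(y, x)` such that `R x` is
the orthogonal projection of `y` on the closure of `ran R`, and `x` is orthogonal to `ker R`. -/
def moorePenroseGraph (R : E →L[ℂ] F) : Submodule ℂ (F × E) where
  carrier := {p | p.2 ∈ (LinearMap.ker (R : E →ₗ[ℂ] F))ᗮ ∧
    p.1 - R p.2 ∈ (LinearMap.range (R : E →ₗ[ℂ] F))ᗮ}
  add_mem' := by
    rintro a b ⟨ha, ha'⟩ ⟨hb, hb'⟩
    refine ⟨Submodule.add_mem _ ha hb, ?_⟩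
    have h := Submodule.add_mem _ ha' hb'
    have e : (a + b).1 - R (a + b).2 = (a.1 - R a.2) + (b.1 - R b.2) := by
      simp only [Prod.fst_add, Prod.snd_add, map_add]
      abel
    rw [e]
    exact h
  zero_mem' := by simp
  smul_mem' := by
    rintro c a ⟨ha, ha'⟩
    refine ⟨Submodule.smul_mem _ c ha, ?_⟩
    have h := Submodule.smul_mem _ c ha'
    have e : (c • a).1 - R (c • a).2 = c • (a.1 - R a.2) := by
      simp [smul_sub]
    rw [e]
    exact h

theorem moorePenroseGraph_single_valued (R : E →L[ℂ] F) (p : F × E)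
    (hp : p ∈ moorePenroseGraph R) (h0 : p.1 = 0) : p.2 = 0 := by
  obtain ⟨h1, h2⟩ := hp
  rw [h0, zero_sub, Submodule.neg_mem_iff] at h2
  have h3 : R p.2 = 0 := by
    have := h2 (R p.2) ⟨p.2, rfl⟩
    exact inner_self_eq_zero.mp this
  have h4 := h1 p.2 h3
  exact inner_self_eq_zero.mp h4

/-- The (in general unbounded) Moore-Penrose inverse `R^[-1]` of `R : E → F`, with domain
`ran R ⊕ (ran R)ᗮ`. -/
def moorePenrose (R : E →L[ℂ] F) : F →ₗ.[ℂ] E := (moorePenroseGraph R).toLinearPMap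

theorem moorePenrose_graph (R : E →L[ℂ] F) : (moorePenrose R).graph = moorePenroseGraph R :=
  Submodule.toLinearPMap_graph_eq _ (moorePenroseGraph_single_valued R)

/-- The block operator `[[A₁₁, A₁₂], [A₂₁, A₂₂]]` on the Hilbert space direct sum `E ⊕ F`. -/
def blockOp (A₁₁ : E →L[ℂ] E) (A₁₂ : F →L[ℂ] E) (A₂₁ : E →L[ℂ] F) (A₂₂ : F →L[ℂ] F) :
    WithLp 2 (E × F) →L[ℂ] WithLp 2 (E × F) :=
  ((WithLp.prodContinuousLinearEquiv 2 ℂ E F).symm : (E × F) →L[ℂ] WithLp 2 (E × F)) ∘L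
    ((A₁₁.coprod A₁₂).prod (A₂₁.coprod A₂₂)) ∘L
    ((WithLp.prodContinuousLinearEquiv 2 ℂ E F) : WithLp 2 (E × F) →L[ℂ] (E × F))

/-- The fundamental symmetry `J = diag(J₁, J₂)` of `E ⊕ F`. -/
def sumSymmetry (J₁ : E →L[ℂ] E) (J₂ : F →L[ℂ] F) :
    WithLp 2 (E × F) →L[ℂ] WithLp 2 (E × F) :=
  blockOp J₁ 0 0 J₂

/-- The solution set: all `A₂₂ = A₂₂^[*]` in `(F, J₂)` for which the completed block operator
`A` has `ν₋[A] = κ` in `(E ⊕ F, diag(J₁, J₂))`. -/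
def solutionSet (J₁ : E →L[ℂ] E) (J₂ : F →L[ℂ] F) (A₁₁ : E →L[ℂ] E) (A₁₂ : F →L[ℂ] E)
    (A₂₁ : E →L[ℂ] F) (κ : ℕ) : Set (F →L[ℂ] F) :=
  {A₂₂ | IsKreinSelfAdjoint J₂ A₂₂ ∧
    negIndex (sumSymmetry J₁ J₂) (blockOp A₁₁ A₁₂ A₂₁ A₂₂) = (κ : ℕ∞)}

end Krein

end

noncomputable section

namespace Krein

open scoped InnerProductSpace ComplexInnerProductSpace

/-! ### Counting negative squares -/

section NegSquares

variable {E : Type*} [NormedAddCommGroup E] [InnerProductSpace ℂ E]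

/-! Multiplying by the fundamental symmetries removes the Krein structure: with `T = J₁A₁₁`, `B =
J₁A₁₂`, `D = J₂A₂₂`, only the Hilbert space form of the selfadjoint block `[[T, B], [B*, D]]`
matters. Write `T = RσR` with `R = |T|^{1/2}`, `σ = sign T`; the negative spectral subspace `N` has
dimension `κ`.

If `B = RS`, completing the square (`completion_square`) turns the form at `(f, g)` into `(σx, x) +
(Yg, g)`, where `x = Rf + σSg` and `Y = D - S*σS`. For `Y ≥ 0` it is nonnegative as soon as `x ⊥ N`,
which is `κ` linear conditions, so there are at most `κ` negative squares.

Conversely, if the block has `κ` negative squares, `N ⊕ 0` is a maximal negative subspace, and the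
form is nonnegative on its form-orthogonal companion (`nonneg_of_orthogonal_of_maximal`). A
discriminant there gives `ran B ⊆ ran R` (`range_subset`); taking `Rf` close to `-σSg` gives `Y ≥ 0`
(`re_inner_nonneg_of_negSquares_le`). Solutions thus correspond to `Y ≥ 0`, the smallest to `Y = 0`.
-/

theorem finrank_le_negSquares {q : E → ℝ} (L : Submodule ℂ E) [hL : FiniteDimensional ℂ L]
    (h : ∀ f ∈ L, f ≠ 0 → q f < 0) : (Module.finrank ℂ L : ℕ∞) ≤ negSquares q :=
  le_iSup_of_le L (le_iSup_of_le hL (le_iSup_of_le h le_rfl))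

/-- A negative definite subspace meets `ker φ` only in `0`, so `φ` embeds it into `V`. -/
theorem negSquares_le_finrank {q : E → ℝ} {V : Type*} [AddCommGroup V] [Module ℂ V]
    [FiniteDimensional ℂ V] (φ : E →ₗ[ℂ] V) (h : ∀ f, φ f = 0 → 0 ≤ q f) :
    negSquares q ≤ (Module.finrank ℂ V : ℕ∞) := by
  refine iSup_le fun L => iSup_le fun hL => iSup_le fun hneg => ?_
  have hinj : Function.Injective (φ.domRestrict L) := by
    rw [injective_iff_map_eq_zero]
    intro x hx
    by_contra hne
    have h1 := hneg x x.2 (fun h0 => hne (Subtype.ext h0))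
    exact absurd (h x hx) (not_le.mpr h1)
  exact_mod_cast LinearMap.finrank_le_finrank_of_injective hinj

/-- `negSquares` tests finite-dimensional subspaces only, so the bound is applied to spans of finite
independent subsets of `W`. -/
theorem finiteDimensional_of_negSquares_eq {q : E → ℝ} {κ : ℕ} (hq : negSquares q = κ)
    (W : Submodule ℂ E) (h : ∀ f ∈ W, f ≠ 0 → q f < 0) : FiniteDimensional ℂ W := by
  have hr : Module.rank ℂ W ≤ κ := by
    refine rank_le fun s hs => ?_
    have hs' : LinearIndependent ℂ (fun i : s => ((i : W) : E)) :=
      hs.map' W.subtype W.ker_subtype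
    have hfin : FiniteDimensional ℂ (Submodule.span ℂ (Set.range fun i : s => ((i : W) : E))) :=
      FiniteDimensional.span_of_finite ℂ (Set.finite_range _)
    have h1 := finrank_le_negSquares (q := q)
      (Submodule.span ℂ (Set.range fun i : s => ((i : W) : E))) (by
        intro f hf hf0
        refine h f ?_ hf0
        refine Submodule.span_le.mpr ?_ hf
        rintro _ ⟨i, rfl⟩
        exact (i : W).2)
    rw [finrank_span_eq_card hs', hq, Fintype.card_coe] at h1
    exact_mod_cast h1
  exact Module.rank_lt_aleph0_iff.mp (lt_of_le_of_lt hr Cardinal.natCast_lt_aleph0)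

/-- A vector that is orthogonal, with respect to the form of `G`, to a negative definite subspace
of maximal dimension is nonnegative. -/
theorem nonneg_of_orthogonal_of_maximal {G : E →L[ℂ] E}
    (hG : ∀ x y, ⟪G x, y⟫_ℂ = ⟪x, G y⟫_ℂ) (L : Submodule ℂ E) [FiniteDimensional ℂ L]
    (hL : ∀ f ∈ L, f ≠ 0 → (⟪f, G f⟫_ℂ).re < 0)
    (hmax : negSquares (fun f => (⟪f, G f⟫_ℂ).re) ≤ Module.finrank ℂ L)
    {w : E} (hw : ∀ l ∈ L, ⟪l, G w⟫_ℂ = 0) : 0 ≤ (⟪w, G w⟫_ℂ).re := by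
  by_contra! hneg
  have hwL : w ∉ L := fun h => by simp [hw w h] at hneg
  have hinf : L ⊓ Submodule.span ℂ {w} = ⊥ := by
    rw [Submodule.eq_bot_iff]
    rintro x ⟨hx, hx'⟩
    obtain ⟨c, rfl⟩ := Submodule.mem_span_singleton.mp hx'
    by_cases hc : c = 0
    · simp [hc]
    · exact absurd ((Submodule.smul_mem_iff _ hc).mp hx) hwL
  have hw0 : w ≠ 0 := fun h => hwL (h ▸ L.zero_mem)
  -- Adjoining `w` raises the dimension by one, yet the sum stays negative definite because the
  -- cross terms vanish.
  have hrank := Submodule.finrank_sup_add_finrank_inf_eq L (Submodule.span ℂ {w})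
  rw [hinf, finrank_bot, finrank_span_singleton hw0] at hrank
  have h1 := finrank_le_negSquares (q := fun f => (⟪f, G f⟫_ℂ).re) (L ⊔ Submodule.span ℂ {w}) (by
    intro f hf hf0
    obtain ⟨l, hl, z, hz, rfl⟩ := Submodule.mem_sup.mp hf
    obtain ⟨c, rfl⟩ := Submodule.mem_span_singleton.mp hz
    have e1 : ⟪w, G l⟫_ℂ = 0 := by
      rw [← hG, ← inner_conj_symm, hw l hl, map_zero]
    have e : (⟪l + c • w, G (l + c • w)⟫_ℂ).re
        = (⟪l, G l⟫_ℂ).re + ‖c‖ ^ 2 * (⟪w, G w⟫_ℂ).re := by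
      have e2 : ⟪l + c • w, G (l + c • w)⟫_ℂ
          = ⟪l, G l⟫_ℂ + ((‖c‖ ^ 2 : ℝ) : ℂ) * ⟪w, G w⟫_ℂ := by
        simp only [map_add, map_smul, inner_add_left, inner_add_right, inner_smul_left,
          inner_smul_right, hw l hl, e1, mul_zero, add_zero, zero_add]
        rw [← mul_assoc, mul_comm c, ← Complex.normSq_eq_conj_mul_self, Complex.normSq_eq_norm_sq]
      rw [e2, Complex.add_re, Complex.re_ofReal_mul]
    change (⟪l + c • w, G (l + c • w)⟫_ℂ).re < 0
    rw [e]
    by_cases hl0 : l = 0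
    · have hc : c ≠ 0 := fun hc => hf0 (by simp [hl0, hc])
      have : 0 < ‖c‖ ^ 2 := by positivity
      simp only [hl0, map_zero, inner_zero_left, Complex.zero_re, zero_add]
      exact mul_neg_of_pos_of_neg this hneg
    · have := hL l hl hl0
      nlinarith [sq_nonneg ‖c‖])
  have h2 := h1.trans hmax
  have h3 : Module.finrank ℂ ↥(L ⊔ Submodule.span ℂ {w}) ≤ Module.finrank ℂ L := by
    exact_mod_cast h2
  omega

end NegSquares

/-! ### A Douglas-type range criterion -/

section Douglas

variable {E : Type*} [NormedAddCommGroup E] [InnerProductSpace ℂ E] [CompleteSpace E]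

/-- By the bound, `R f ↦ ⟪u, f⟫` is a well-defined bounded functional on `ran R`. A Hahn–Banach
extension, represented by Riesz, is a preimage of `u`. -/
theorem mem_range_of_norm_inner_le {R : E →L[ℂ] E} (hR : ∀ x y, ⟪R x, y⟫_ℂ = ⟪x, R y⟫_ℂ)
    {u : E} {C : ℝ} (h : ∀ f, ‖⟪u, f⟫_ℂ‖ ≤ C * ‖R f‖) : u ∈ Set.range R := by
  -- The algebraic section `s` need not be continuous; continuity of `ψ` comes from `h`, and `h2`
  -- below shows that the choice of preimage is immaterial.
  obtain ⟨s, hs⟩ := (R : E →ₗ[ℂ] E).rangeRestrict.exists_rightInverse_of_surjective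
    (LinearMap.range_rangeRestrict _)
  have hs' : ∀ y, R (s y) = y := fun y => congrArg Subtype.val (LinearMap.congr_fun hs y)
  let ψ : LinearMap.range (R : E →ₗ[ℂ] E) →L[ℂ] ℂ :=
    LinearMap.mkContinuous ((innerSL ℂ u : E →ₗ[ℂ] ℂ) ∘ₗ s) C (fun y => by
      have := h (s y)
      rw [hs'] at this
      simpa using this)
  obtain ⟨g, hg, -⟩ := exists_extension_norm_eq _ ψ
  refine ⟨(InnerProductSpace.toDual ℂ E).symm g, ?_⟩
  refine ext_inner_right ℂ fun f => ?_
  rw [hR, InnerProductSpace.toDual_symm_apply]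
  have h1 : g (R f) = ⟪u, s ⟨R f, f, rfl⟩⟫_ℂ := hg ⟨R f, f, rfl⟩
  have h2 : ⟪u, s ⟨R f, f, rfl⟩ - f⟫_ℂ = 0 := by
    have := h (s ⟨R f, f, rfl⟩ - f)
    rw [map_sub, hs', sub_self, norm_zero, mul_zero] at this
    exact norm_le_zero_iff.mp this
  rw [h1]
  rwa [inner_sub_right, sub_eq_zero] at h2

end Douglas

/-! ### Boundedness of the Moore–Penrose composition -/

section MoorePenrose

variable {E F : Type*} [NormedAddCommGroup E] [InnerProductSpace ℂ E] [CompleteSpace E]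
  [NormedAddCommGroup F] [InnerProductSpace ℂ F] [CompleteSpace F]

/-- Closed graph theorem: `S g` is the only `x ⊥ ker R` with `R x = B g`, and both conditions are
closed in `(g, x)`. -/
theorem exists_moorePenrose_comp {G : Type*} [NormedAddCommGroup G] [InnerProductSpace ℂ G]
    [CompleteSpace G] (R : E →L[ℂ] F) (B : G →L[ℂ] F) (h : Set.range B ⊆ Set.range R) :
    ∃ S : G →L[ℂ] E,
      (∀ g, ∃ hg : B g ∈ (moorePenrose R).domain, S g = moorePenrose R ⟨B g, hg⟩) ∧
      (∀ g, R (S g) = B g) ∧ ∀ g, S g ∈ (LinearMap.ker (R : E →ₗ[ℂ] F))ᗮ := by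
  have hex : ∀ g, ∃ x, x ∈ (LinearMap.ker (R : E →ₗ[ℂ] F))ᗮ ∧ R x = B g := by
    intro g
    obtain ⟨x, hx⟩ := h ⟨g, rfl⟩
    have hcl : IsClosed ((LinearMap.ker (R : E →ₗ[ℂ] F) : Submodule ℂ E) : Set E) := R.isClosed_ker
    have : CompleteSpace (LinearMap.ker (R : E →ₗ[ℂ] F)) := hcl.completeSpace_coe
    obtain ⟨y, hy, z, hz, hyz⟩ :=
      (LinearMap.ker (R : E →ₗ[ℂ] F)).exists_add_mem_mem_orthogonal x
    have hy' : R y = 0 := hy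
    refine ⟨z, hz, ?_⟩
    rw [← hx, hyz, map_add, hy', zero_add]
  have hmem : ∀ g x, x ∈ (LinearMap.ker (R : E →ₗ[ℂ] F))ᗮ → R x = B g →
      (B g, x) ∈ (moorePenrose R).graph := by
    intro g x hx hRx
    rw [moorePenrose_graph]
    refine ⟨hx, ?_⟩
    simp [hRx]
  have hdom : ∀ g, B g ∈ (moorePenrose R).domain := by
    intro g
    obtain ⟨x, hx, hRx⟩ := hex g
    exact LinearPMap.mem_domain_of_mem_graph (hmem g x hx hRx)
  let S₀ : G →ₗ[ℂ] E :=
    (moorePenrose R).toFun ∘ₗ (B : G →ₗ[ℂ] F).codRestrict (moorePenrose R).domain hdom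
  have hS₀ : ∀ g x, S₀ g = x ↔ x ∈ (LinearMap.ker (R : E →ₗ[ℂ] F))ᗮ ∧ R x = B g := by
    intro g x
    obtain ⟨y, hy, hRy⟩ := hex g
    have h1 : S₀ g = y := ((LinearPMap.image_iff (hdom g)).mpr (hmem g y hy hRy)).symm
    refine ⟨fun hx => ?_, fun ⟨hx, hRx⟩ => ?_⟩
    · rw [← hx, h1]
      exact ⟨hy, hRy⟩
    · exact ((LinearPMap.image_iff (hdom g)).mpr (hmem g x hx hRx)).symm
  have hclosed : IsClosed (S₀.graph : Set (G × E)) := by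
    have e : (S₀.graph : Set (G × E)) =
        {p | p.2 ∈ (LinearMap.ker (R : E →ₗ[ℂ] F))ᗮ} ∩ {p | R p.2 = B p.1} := by
      ext p
      simp only [SetLike.mem_coe, LinearMap.mem_graph_iff, Set.mem_inter_iff, Set.mem_ofPred_eq]
      rw [eq_comm]
      exact hS₀ p.1 p.2
    rw [e]
    refine IsClosed.inter ?_ ?_
    · exact (Submodule.isClosed_orthogonal _).preimage continuous_snd
    · exact isClosed_eq (by fun_prop) (by fun_prop)
  refine ⟨⟨S₀, S₀.continuous_of_isClosed_graph hclosed⟩, fun g => ⟨hdom g, rfl⟩, fun g => ?_,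
    fun g => ?_⟩
  · exact ((hS₀ g _).mp rfl).2
  · exact ((hS₀ g _).mp rfl).1

end MoorePenrose

/-- The factorisation `T = R σ R` of a selfadjoint operator `T` with `R = |T|^{1/2}` and
`σ = sign T` and the spectral subspace `N = ker (1 + σ)` of `T` for `(-∞, 0)`. -/
structure IsSignFactorization {E : Type*} [NormedAddCommGroup E] [InnerProductSpace ℂ E]
    (T R σ : E →L[ℂ] E) (N : Submodule ℂ E) : Prop where
  symm_root : ∀ x y, ⟪R x, y⟫_ℂ = ⟪x, R y⟫_ℂ
  symm_sign : ∀ x y, ⟪σ x, y⟫_ℂ = ⟪x, σ y⟫_ℂ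
  sign_sign : ∀ x, σ (σ x) = x
  comm : ∀ x, σ (R x) = R (σ x)
  eq_mul : ∀ x, T x = R (σ (R x))
  sign_of_mem : ∀ n ∈ N, σ n = -n
  sign_of_mem_orthogonal : ∀ m ∈ Nᗮ, σ m = m
  root_mem : ∀ n ∈ N, R n ∈ N
  root_injective : ∀ n ∈ N, R n = 0 → n = 0

namespace IsSignFactorization

variable {E : Type*} [NormedAddCommGroup E] [InnerProductSpace ℂ E]
  {T R σ : E →L[ℂ] E} {N : Submodule ℂ E}

theorem symm (h : IsSignFactorization T R σ N) (x y : E) : ⟪T x, y⟫_ℂ = ⟪x, T y⟫_ℂ := by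
  rw [h.eq_mul, h.eq_mul, h.symm_root, h.symm_sign, h.symm_root]

theorem apply_of_mem (h : IsSignFactorization T R σ N) {n : E} (hn : n ∈ N) :
    T n = -R (R n) := by
  rw [h.eq_mul, h.sign_of_mem _ (h.root_mem n hn), map_neg]

theorem exists_root_eq [FiniteDimensional ℂ N] (h : IsSignFactorization T R σ N) {n : E} (hn : n ∈ N) :
    ∃ m ∈ N, R m = n := by
  let r : N →ₗ[ℂ] N := (R : E →ₗ[ℂ] E).restrict h.root_mem
  have hr : Function.Injective r := by
    rw [injective_iff_map_eq_zero]
    intro x hx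
    exact Subtype.ext (h.root_injective x x.2 (congrArg Subtype.val hx))
  obtain ⟨m, hm⟩ := LinearMap.injective_iff_surjective.mp hr ⟨n, hn⟩
  exact ⟨m, m.2, congrArg Subtype.val hm⟩

theorem re_inner_neg (h : IsSignFactorization T R σ N) {n : E} (hn : n ∈ N) (hn0 : n ≠ 0) :
    (⟪n, T n⟫_ℂ).re < 0 := by
  rw [h.apply_of_mem hn, inner_neg_right, ← h.symm_root, Complex.neg_re,
    inner_self_eq_norm_sq_to_K]
  have : R n ≠ 0 := fun h0 => hn0 (h.root_injective n hn h0)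
  have h2 : 0 < ‖R n‖ ^ 2 := by positivity
  exact neg_neg_of_pos (by exact_mod_cast h2)

theorem re_inner_sign (h : IsSignFactorization T R σ N) {x : E} (hx : x ∈ Nᗮ) :
    (⟪x, σ x⟫_ℂ).re = ‖x‖ ^ 2 := by
  rw [h.sign_of_mem_orthogonal x hx, inner_self_eq_norm_sq_to_K]
  norm_cast

theorem negSquares_eq [FiniteDimensional ℂ N] (h : IsSignFactorization T R σ N) :
    negSquares (fun f => (⟪f, T f⟫_ℂ).re) = Module.finrank ℂ N := by
  refine le_antisymm ?_ (finrank_le_negSquares N fun f hf hf0 => h.re_inner_neg hf hf0)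
  refine negSquares_le_finrank
    ((N.orthogonalProjectionOnto : E →ₗ[ℂ] N) ∘ₗ (R : E →ₗ[ℂ] E)) fun f hf => ?_
  have hf' : R f ∈ Nᗮ := Submodule.orthogonalProjectionOnto_eq_zero_iff.mp hf
  rw [h.eq_mul, ← h.symm_root, h.re_inner_sign hf']
  positivity

end IsSignFactorization

/-! ### Block operators and their completions -/

section Block

variable {E F : Type*} [NormedAddCommGroup E] [InnerProductSpace ℂ E]
  [NormedAddCommGroup F] [InnerProductSpace ℂ F]

theorem blockOp_apply (A₁₁ : E →L[ℂ] E) (A₁₂ : F →L[ℂ] E) (A₂₁ : E →L[ℂ] F) (A₂₂ : F →L[ℂ] F)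
    (w : WithLp 2 (E × F)) :
    blockOp A₁₁ A₁₂ A₂₁ A₂₂ w =
      WithLp.toLp 2 (A₁₁ w.fst + A₁₂ w.snd, A₂₁ w.fst + A₂₂ w.snd) := rfl

theorem inner_blockOp (A₁₁ : E →L[ℂ] E) (A₁₂ : F →L[ℂ] E) (A₂₁ : E →L[ℂ] F) (A₂₂ : F →L[ℂ] F)
    (v w : WithLp 2 (E × F)) :
    ⟪v, blockOp A₁₁ A₁₂ A₂₁ A₂₂ w⟫_ℂ =
      ⟪v.fst, A₁₁ w.fst + A₁₂ w.snd⟫_ℂ + ⟪v.snd, A₂₁ w.fst + A₂₂ w.snd⟫_ℂ := by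
  rw [blockOp_apply, WithLp.prod_inner_apply]
  rfl

theorem blockOp_symm [CompleteSpace E] [CompleteSpace F] {T : E →L[ℂ] E} (hT : ∀ x y, ⟪T x, y⟫_ℂ = ⟪x, T y⟫_ℂ) (B : F →L[ℂ] E)
    {D : F →L[ℂ] F} (hD : ∀ x y, ⟪D x, y⟫_ℂ = ⟪x, D y⟫_ℂ) (v w : WithLp 2 (E × F)) :
    ⟪blockOp T B (ContinuousLinearMap.adjoint B) D v, w⟫_ℂ =
      ⟪v, blockOp T B (ContinuousLinearMap.adjoint B) D w⟫_ℂ := by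
  rw [← inner_conj_symm, inner_blockOp, inner_blockOp]
  simp only [inner_add_right, map_add, inner_conj_symm, ContinuousLinearMap.adjoint_inner_right,
    hT, hD]
  ring

end Block

namespace IsSignFactorization

variable {E F : Type*} [NormedAddCommGroup E] [InnerProductSpace ℂ E]
  [NormedAddCommGroup F] [InnerProductSpace ℂ F]
  {T R σ : E →L[ℂ] E} {N : Submodule ℂ E} {B S : F →L[ℂ] E} {D Y : F →L[ℂ] F}

/-- The subspace `N ⊕ 0` of `E ⊕ F`. -/
def inlSubmodule (F : Type*) [NormedAddCommGroup F] [InnerProductSpace ℂ F]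
    (N : Submodule ℂ E) : Submodule ℂ (WithLp 2 (E × F)) :=
  N.map (((WithLp.linearEquiv 2 ℂ (E × F)).symm : (E × F) →ₗ[ℂ] WithLp 2 (E × F)) ∘ₗ
    LinearMap.inl ℂ E F)

theorem finrank_inlSubmodule (F : Type*) [NormedAddCommGroup F] [InnerProductSpace ℂ F]
    (N : Submodule ℂ E) : Module.finrank ℂ (inlSubmodule F N) = Module.finrank ℂ N := by
  refine (Submodule.equivMapOfInjective _ ?_ N).finrank_eq.symm
  exact (WithLp.linearEquiv 2 ℂ (E × F)).symm.injective.comp LinearMap.inl_injective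

theorem mem_inlSubmodule {N : Submodule ℂ E} {w : WithLp 2 (E × F)} :
    w ∈ inlSubmodule F N ↔ ∃ n ∈ N, WithLp.toLp 2 (n, (0 : F)) = w := Iff.rfl

theorem re_inner_blockOp_neg (h : IsSignFactorization T R σ N) (B : F →L[ℂ] E) (C : E →L[ℂ] F)
    (D : F →L[ℂ] F) (w : WithLp 2 (E × F)) (hw : w ∈ inlSubmodule F N) (hw0 : w ≠ 0) :
    (⟪w, blockOp T B C D w⟫_ℂ).re < 0 := by
  obtain ⟨n, hn, rfl⟩ := mem_inlSubmodule.mp hw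
  have hn0 : n ≠ 0 := by
    rintro rfl
    exact hw0 rfl
  rw [inner_blockOp]
  simpa using h.re_inner_neg hn hn0

theorem finrank_le_negSquares_blockOp [FiniteDimensional ℂ N] (h : IsSignFactorization T R σ N) (B : F →L[ℂ] E)
    (C : E →L[ℂ] F) (D : F →L[ℂ] F) :
    (Module.finrank ℂ N : ℕ∞) ≤ negSquares (fun w => (⟪w, blockOp T B C D w⟫_ℂ).re) := by
  have : FiniteDimensional ℂ (inlSubmodule F N) := by unfold inlSubmodule; infer_instance
  rw [← finrank_inlSubmodule F N]
  exact finrank_le_negSquares _ (h.re_inner_blockOp_neg B C D)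

/-- Since `σ² = 1`, the shift `σ (S g)` produces exactly the cross term `⟪R f, S g⟫ = ⟪f, B g⟫`. -/
theorem completion_square (h : IsSignFactorization T R σ N) (hS : ∀ g, R (S g) = B g)
    (hDY : ∀ g, ⟪g, D g⟫_ℂ = ⟪S g, σ (S g)⟫_ℂ + ⟪g, Y g⟫_ℂ) (f : E) (g : F) :
    (⟪f, T f⟫_ℂ).re + 2 * (⟪f, B g⟫_ℂ).re + (⟪g, D g⟫_ℂ).re =
      (⟪R f + σ (S g), σ (R f + σ (S g))⟫_ℂ).re + (⟪g, Y g⟫_ℂ).re := by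
  have e1 : ⟪f, B g⟫_ℂ = ⟪R f, S g⟫_ℂ := by rw [← hS, h.symm_root]
  have e2 : ⟪f, T f⟫_ℂ = ⟪R f, σ (R f)⟫_ℂ := by rw [h.eq_mul, h.symm_root]
  have e3 : ⟪σ (S g), σ (R f)⟫_ℂ = ⟪S g, R f⟫_ℂ := by rw [h.symm_sign, h.sign_sign]
  have e4 : (⟪S g, R f⟫_ℂ).re = (⟪R f, S g⟫_ℂ).re := by rw [← inner_conj_symm, Complex.conj_re]
  rw [e1, e2, hDY, map_add, h.sign_sign]
  simp only [inner_add_left, inner_add_right, Complex.add_re, e3, e4, h.symm_sign]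
  ring

variable [CompleteSpace E] [CompleteSpace F]

/-- Form-orthogonality to `N ⊕ 0` involves only the first row `T f + B g`. -/
theorem re_inner_blockOp_nonneg [FiniteDimensional ℂ N] (h : IsSignFactorization T R σ N)
    (hD : ∀ x y, ⟪D x, y⟫_ℂ = ⟪x, D y⟫_ℂ)
    (hmax : negSquares (fun w =>
      (⟪w, blockOp T B (ContinuousLinearMap.adjoint B) D w⟫_ℂ).re) ≤ Module.finrank ℂ N)
    {f : E} {g : F} (hfg : ∀ n ∈ N, ⟪n, T f + B g⟫_ℂ = 0) :
    0 ≤ (⟪f, T f⟫_ℂ).re + 2 * (⟪f, B g⟫_ℂ).re + (⟪g, D g⟫_ℂ).re := by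
  have : FiniteDimensional ℂ (inlSubmodule F N) := by unfold inlSubmodule; infer_instance
  rw [← finrank_inlSubmodule F N] at hmax
  have key := nonneg_of_orthogonal_of_maximal (blockOp_symm h.symm B hD) (inlSubmodule F N)
    (h.re_inner_blockOp_neg B _ D) hmax (w := WithLp.toLp 2 (f, g)) (by
      intro l hl
      obtain ⟨n, hn, rfl⟩ := mem_inlSubmodule.mp hl
      rw [inner_blockOp]
      simpa using hfg n hn)
  rw [inner_blockOp] at key
  simp only [inner_add_right, ContinuousLinearMap.adjoint_inner_right, Complex.add_re,
    WithLp.toLp_fst, WithLp.toLp_snd] at key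
  have e : (⟪B g, f⟫_ℂ).re = (⟪f, B g⟫_ℂ).re := by
    rw [← inner_conj_symm, Complex.conj_re]
  rw [e] at key
  linarith

theorem range_subset [FiniteDimensional ℂ N] (h : IsSignFactorization T R σ N)
    (hD : ∀ x y, ⟪D x, y⟫_ℂ = ⟪x, D y⟫_ℂ)
    (hmax : negSquares (fun w =>
      (⟪w, blockOp T B (ContinuousLinearMap.adjoint B) D w⟫_ℂ).re) ≤ Module.finrank ℂ N) :
    Set.range B ⊆ Set.range R := by
  rintro _ ⟨g, rfl⟩
  obtain ⟨b, hb, c, hc, hbc⟩ := N.exists_add_mem_mem_orthogonal (B g)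
  obtain ⟨n', hn', rfl⟩ := h.exists_root_eq hb
  -- Two preimages under `R`, as `T = -R²` on `N`: this `n` makes `T n` cancel the `N`-component of
  -- `B g`.
  obtain ⟨n, hn, rfl⟩ := h.exists_root_eq hn'
  suffices hcR : c ∈ Set.range R by
    obtain ⟨x, rfl⟩ := hcR
    exact ⟨R n + x, by rw [hbc, map_add]⟩
  have hTn : T n = -R (R n) := h.apply_of_mem hn
  have hu : T n + B g = c := by rw [hTn, hbc]; abel
  set K : ℝ := (⟪n, T n⟫_ℂ).re + 2 * (⟪n, B g⟫_ℂ).re + (⟪g, D g⟫_ℂ).re with hK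
  have horth : ∀ p ∈ Nᗮ, 0 ≤ ‖R p‖ ^ 2 + 2 * (⟪p, c⟫_ℂ).re + K := by
    intro p hp
    have hTp : ∀ m ∈ N, ⟪m, T p⟫_ℂ = 0 := by
      intro m hm
      rw [← h.symm, h.apply_of_mem hm]
      exact hp _ (N.neg_mem (h.root_mem _ (h.root_mem _ hm)))
    have hRp : R p ∈ Nᗮ := by
      intro m hm
      rw [← h.symm_root]
      exact hp _ (h.root_mem m hm)
    have h1 := h.re_inner_blockOp_nonneg hD hmax (f := p + n) (g := g) (by
      intro m hm
      rw [map_add, add_assoc, hu, inner_add_right, hTp m hm, hc m hm, add_zero])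
    have h2 : (⟪p, T p⟫_ℂ).re = ‖R p‖ ^ 2 := by
      rw [h.eq_mul, ← h.symm_root, h.re_inner_sign hRp]
    have h3 : ⟪p, T n⟫_ℂ = 0 := by
      rw [← h.symm, ← inner_conj_symm, hTp n hn, map_zero]
    have h4 : ⟪p, c⟫_ℂ = ⟪p, B g⟫_ℂ := by
      rw [← hu, inner_add_right, h3, zero_add]
    simp only [map_add, inner_add_left, inner_add_right, hTp n hn, h3, Complex.add_re, h2,
      Complex.zero_re] at h1
    rw [h4, hK]
    linarith
  have hK0 : 0 ≤ K := by simpa using horth 0 (Submodule.zero_mem _)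
  have hbound : ∀ p ∈ Nᗮ, ‖⟪c, p⟫_ℂ‖ ≤ √K * ‖R p‖ := by
    intro p hp
    set b : ℂ := ⟪c, p⟫_ℂ with hbdef
    have hquad : ∀ t : ℝ, 0 ≤ (‖b‖ ^ 2 * ‖R p‖ ^ 2) * (t * t) + (2 * ‖b‖ ^ 2) * t + K := by
      intro t
      -- The factor `conj b` makes the cross term the real number `t‖b‖²`; the discriminant in `t`
      -- then bounds `‖b‖²` by `K‖R p‖²`.
      have h1 := horth (((t : ℂ) * (starRingEnd ℂ) b) • p) (Submodule.smul_mem _ _ hp)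
      have h2 : ⟪((t : ℂ) * (starRingEnd ℂ) b) • p, c⟫_ℂ = ((t * ‖b‖ ^ 2 : ℝ) : ℂ) := by
        rw [inner_smul_left, ← inner_conj_symm p c, ← hbdef, map_mul, Complex.conj_ofReal,
          Complex.conj_conj, mul_assoc, Complex.mul_conj, Complex.normSq_eq_norm_sq]
        push_cast
        ring
      rw [h2, Complex.ofReal_re, map_smul, norm_smul, norm_mul, RCLike.norm_conj,
        Complex.norm_real, mul_pow, mul_pow, Real.norm_eq_abs, sq_abs] at h1
      linarith
    have hdisc := discrim_le_zero hquad
    rw [discrim] at hdisc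
    rw [← Real.sqrt_sq (norm_nonneg (R p)), ← Real.sqrt_mul hK0]
    refine Real.le_sqrt_of_sq_le ?_
    by_cases hb0 : ‖b‖ = 0
    · rw [hb0, zero_pow two_ne_zero]
      exact mul_nonneg hK0 (sq_nonneg _)
    · have hpos : 0 < ‖b‖ ^ 2 := by positivity
      have : ‖b‖ ^ 2 * (‖b‖ ^ 2 - K * ‖R p‖ ^ 2) ≤ 0 := by linarith
      nlinarith
  refine mem_range_of_norm_inner_le h.symm_root (C := √K) fun f => ?_
  obtain ⟨m, hm, p, hp, rfl⟩ := N.exists_add_mem_mem_orthogonal f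
  have h1 : ⟪c, m⟫_ℂ = 0 := by rw [← inner_conj_symm, hc m hm, map_zero]
  rw [inner_add_right, h1, zero_add, map_add]
  refine (hbound p hp).trans ?_
  gcongr
  have h2 : ⟪R m, R p⟫_ℂ = 0 := by
    rw [← h.symm_root]
    exact hp _ (h.root_mem _ (h.root_mem m hm))
  have h3 := norm_add_sq_eq_norm_sq_add_norm_sq_of_inner_eq_zero _ _ h2
  refine le_of_sq_le_sq ?_ (norm_nonneg _)
  nlinarith [mul_self_nonneg ‖R m‖]

theorem negSquares_blockOp_eq [FiniteDimensional ℂ N] (h : IsSignFactorization T R σ N) (hS : ∀ g, R (S g) = B g)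
    (hDY : ∀ g, ⟪g, D g⟫_ℂ = ⟪S g, σ (S g)⟫_ℂ + ⟪g, Y g⟫_ℂ) (hY : ∀ g, 0 ≤ (⟪g, Y g⟫_ℂ).re) :
    negSquares (fun w => (⟪w, blockOp T B (ContinuousLinearMap.adjoint B) D w⟫_ℂ).re) =
      Module.finrank ℂ N := by
  refine le_antisymm ?_ (h.finrank_le_negSquares_blockOp B _ D)
  refine negSquares_le_finrank ((N.orthogonalProjectionOnto : E →ₗ[ℂ] N) ∘ₗ
    (R.coprod (σ ∘L S) : E × F →ₗ[ℂ] E) ∘ₗ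
    (WithLp.linearEquiv 2 ℂ (E × F) : WithLp 2 (E × F) →ₗ[ℂ] E × F)) fun w hw => ?_
  have hw' : R w.fst + σ (S w.snd) ∈ Nᗮ := Submodule.orthogonalProjectionOnto_eq_zero_iff.mp hw
  have key := h.completion_square hS hDY w.fst w.snd
  rw [h.re_inner_sign hw'] at key
  rw [inner_blockOp]
  simp only [inner_add_right, ContinuousLinearMap.adjoint_inner_right, Complex.add_re]
  have e : (⟪B w.snd, w.fst⟫_ℂ).re = (⟪w.fst, B w.snd⟫_ℂ).re := by
    rw [← inner_conj_symm, Complex.conj_re]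
  rw [e]
  nlinarith [hY w.snd, sq_nonneg ‖R w.fst + σ (S w.snd)‖]

/-- The square would vanish at `R f = -σ (S g)`, but that vector lies only in the closure of `ran
R`. An approximation suffices: the `N`-part of its error is removed exactly, since `R` maps `N` onto
`N`, and the rest costs at most `ε`. -/
theorem re_inner_nonneg_of_negSquares_le [FiniteDimensional ℂ N] (h : IsSignFactorization T R σ N)
    (hS : ∀ g, R (S g) = B g) (hSk : ∀ g, S g ∈ (LinearMap.ker (R : E →ₗ[ℂ] E))ᗮ)
    (hD : ∀ x y, ⟪D x, y⟫_ℂ = ⟪x, D y⟫_ℂ)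
    (hDY : ∀ g, ⟪g, D g⟫_ℂ = ⟪S g, σ (S g)⟫_ℂ + ⟪g, Y g⟫_ℂ)
    (hmax : negSquares (fun w =>
      (⟪w, blockOp T B (ContinuousLinearMap.adjoint B) D w⟫_ℂ).re) ≤ Module.finrank ℂ N)
    (g : F) : 0 ≤ (⟪g, Y g⟫_ℂ).re := by
  have hmem : -σ (S g) ∈ closure (Set.range R) := by
    have h1 : -σ (S g) ∈ (LinearMap.ker (R : E →ₗ[ℂ] E))ᗮ := by
      refine Submodule.neg_mem _ fun k hk => ?_
      have hk' : R k = 0 := hk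
      rw [← h.symm_sign]
      refine hSk g _ ?_
      change R (σ k) = 0
      rw [← h.comm, hk', map_zero]
    have hadj : ContinuousLinearMap.adjoint R = R :=
      ((ContinuousLinearMap.eq_adjoint_iff R R).mpr h.symm_root).symm
    rw [ContinuousLinearMap.orthogonal_ker, hadj] at h1
    exact h1
  refine le_of_forall_pos_le_add fun ε hε => ?_
  obtain ⟨_, ⟨f₀, rfl⟩, hf₀⟩ := Metric.mem_closure_iff.mp hmem (√ε) (Real.sqrt_pos.mpr hε)
  obtain ⟨m, hm, p, hp, hmp⟩ := N.exists_add_mem_mem_orthogonal (R f₀ + σ (S g))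
  obtain ⟨n, hn, rfl⟩ := h.exists_root_eq hm
  have hx : R (f₀ - n) + σ (S g) = p := by
    rw [map_sub, sub_add_eq_add_sub, hmp, add_sub_cancel_left]
  have hnorm : ‖p‖ ^ 2 ≤ ε := by
    have h1 := norm_add_sq_eq_norm_sq_add_norm_sq_of_inner_eq_zero _ _ (hp _ hm)
    rw [← hmp] at h1
    have h2 : ‖R f₀ + σ (S g)‖ < √ε := by
      rwa [dist_eq_norm, ← neg_add', norm_neg, add_comm] at hf₀
    have h3 : ‖R f₀ + σ (S g)‖ ^ 2 ≤ ε := by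
      rw [← Real.sq_sqrt hε.le]
      gcongr
    nlinarith [mul_self_nonneg ‖R n‖]
  have key := h.re_inner_blockOp_nonneg hD hmax (f := f₀ - n) (g := g) (by
    intro l hl
    have e : T (f₀ - n) + B g = R (σ p) := by
      rw [← hx, map_add, map_add, h.sign_sign, hS, h.eq_mul]
    rw [e, ← h.symm_root, h.sign_of_mem_orthogonal p hp]
    exact hp _ (h.root_mem l hl))
  rw [h.completion_square hS hDY, hx, h.re_inner_sign hp] at key
  linarith

end IsSignFactorization

/-! ### The sign factorisation of a selfadjoint operator -/

section SignOp

variable {E : Type*} [NormedAddCommGroup E] [InnerProductSpace ℂ E] [CompleteSpace E]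

theorem signOp_apply_eq_neg_iff (T : E →L[ℂ] E) (x : E) :
    signOp T x = -x ↔ x ∈ (LinearMap.ker ((T⁻ : E →L[ℂ] E) : E →ₗ[ℂ] E))ᗮ := by
  rw [← Submodule.reflection_eq_self_iff, Submodule.reflection_orthogonal_apply, neg_eq_iff_eq_neg]
  rfl

theorem signOp_apply_eq_self_iff (T : E →L[ℂ] E) (x : E) : signOp T x = x ↔ T⁻ x = 0 :=
  Submodule.reflection_eq_self_iff x

theorem isSignFactorization {T : E →L[ℂ] E} (hT : IsSelfAdjoint T) :
    IsSignFactorization T (CFC.sqrt (CFC.abs T)) (signOp T)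
      (LinearMap.ker ((T⁻ : E →L[ℂ] E) : E →ₗ[ℂ] E))ᗮ := by
  set R := CFC.sqrt (CFC.abs T) with hR
  set σ := signOp T with hσ
  have hσσ : ∀ x, σ (σ x) = x := fun x => Submodule.reflection_reflection _ x
  have hσsymm : ∀ x y, ⟪σ x, y⟫_ℂ = ⟪x, σ y⟫_ℂ := fun x y => by
    conv_lhs => rw [← hσσ y]
    exact LinearIsometryEquiv.inner_map_map (Submodule.reflection _) x (σ y)
  have hσsa : IsSelfAdjoint σ :=
    ContinuousLinearMap.isSelfAdjoint_iff_isSymmetric.mpr fun x y => hσsymm x y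
  have hneg : IsSelfAdjoint (T⁻) := (CFC.negPart_nonneg T).isSelfAdjoint
  have hpos : IsSelfAdjoint (T⁺) := (CFC.posPart_nonneg T).isSelfAdjoint
  have hσpos : σ * T⁺ = T⁺ := by
    ext x
    refine (signOp_apply_eq_self_iff T _).mpr ?_
    exact congrArg (fun L : E →L[ℂ] E => L x) (CFC.negPart_mul_posPart T)
  have hσneg : σ * T⁻ = -T⁻ := by
    ext x
    refine (signOp_apply_eq_neg_iff T _).mpr fun k hk => ?_
    have hk' : T⁻ k = 0 := hk
    rw [← ContinuousLinearMap.isSelfAdjoint_iff_isSymmetric.mp hneg k x]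
    simp [hk']
  have hposσ : T⁺ * σ = T⁺ := by
    have := congrArg star hσpos
    rwa [star_mul, hσsa.star_eq, hpos.star_eq] at this
  have hnegσ : T⁻ * σ = -T⁻ := by
    have := congrArg star hσneg
    rwa [star_mul, star_neg, hσsa.star_eq, hneg.star_eq] at this
  have habs : CFC.abs T = T⁺ + T⁻ := (CFC.posPart_add_negPart T hT).symm
  have hTeq : σ * CFC.abs T = T := by
    rw [habs, mul_add, hσpos, hσneg, ← sub_eq_add_neg, CFC.posPart_sub_negPart T hT]
  have hcomm : Commute (CFC.abs T) σ := by
    rw [habs]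
    change (T⁺ + T⁻) * σ = σ * (T⁺ + T⁻)
    rw [mul_add, add_mul, hσpos, hσneg, hposσ, hnegσ]
  have hRσ : Commute R σ := hcomm.cfcₙ_nnreal _
  have hRR : R * R = CFC.abs T := CFC.sqrt_mul_sqrt_self _ (CFC.abs_nonneg T)
  have hRsa : IsSelfAdjoint R := (CFC.sqrt_nonneg _).isSelfAdjoint
  have hRσ' : ∀ x, σ (R x) = R (σ x) := fun x =>
    (congrArg (fun L : E →L[ℂ] E => L x) hRσ.eq).symm
  have hRR' : ∀ x, R (R x) = CFC.abs T x := fun x => congrArg (fun L : E →L[ℂ] E => L x) hRR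
  have hTeq' : ∀ x, σ (CFC.abs T x) = T x := fun x => congrArg (fun L : E →L[ℂ] E => L x) hTeq
  refine ⟨fun x y => ContinuousLinearMap.isSelfAdjoint_iff_isSymmetric.mp hRsa x y, hσsymm, hσσ,
    hRσ', fun x => ?_, fun n hn => (signOp_apply_eq_neg_iff T n).mpr hn, fun m hm => ?_,
    fun n hn => ?_, fun n hn hn0 => ?_⟩
  · rw [hRσ', hRR', ← hTeq', ← hRR', hRσ', hRσ', hRR']
  · rw [Submodule.orthogonal_orthogonal] at hm
    exact (signOp_apply_eq_self_iff T m).mpr hm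
  · rw [← signOp_apply_eq_neg_iff] at hn ⊢
    rw [← hσ, hRσ', hσ, hn, map_neg]
  · have h1 : CFC.abs T n = 0 := by rw [← hRR', hn0, map_zero]
    have h2 : T n = 0 := by rw [← hTeq', h1, map_zero]
    -- From `|T| - T = 2T⁻`, the vector `n` lies in `ker T⁻` as well as in its orthogonal
    -- complement.
    have h3 : (2 • T⁻) n = 0 := by
      rw [← CFC.abs_sub_self T hT, sub_apply, h1, h2, sub_zero]
    have h4 : T⁻ n = 0 := by
      rw [two_nsmul, add_apply, ← two_smul ℂ] at h3
      exact (smul_eq_zero.mp h3).resolve_left two_ne_zero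
    exact inner_self_eq_zero.mp (hn n h4)

end SignOp

/-! ### Passing from Krein to Hilbert space -/

section Symmetry

variable {E : Type*} [NormedAddCommGroup E] [InnerProductSpace ℂ E] [CompleteSpace E]

theorem IsFundamentalSymmetry.apply_apply {J : E →L[ℂ] E} (hJ : IsFundamentalSymmetry J) (x : E) :
    J (J x) = x :=
  congrArg (fun L : E →L[ℂ] E => L x) hJ.2

theorem IsFundamentalSymmetry.comp_comp {J : E →L[ℂ] E} (hJ : IsFundamentalSymmetry J)
    {G : Type*} [NormedAddCommGroup G] [InnerProductSpace ℂ G] (A : G →L[ℂ] E) :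
    J ∘L J ∘L A = A := by
  ext x
  exact hJ.apply_apply _

theorem isKreinSelfAdjoint_iff {J : E →L[ℂ] E} (hJ : IsFundamentalSymmetry J) (A : E →L[ℂ] E) :
    IsKreinSelfAdjoint J A ↔ IsSelfAdjoint (J ∘L A) := by
  rw [IsKreinSelfAdjoint, kreinAdjoint, IsSelfAdjoint, ContinuousLinearMap.star_eq_adjoint,
    ContinuousLinearMap.adjoint_comp, hJ.1]
  refine ⟨fun h => ?_, fun h => ?_⟩
  · conv_rhs => rw [h]
    rw [hJ.comp_comp]
  · rw [h, hJ.comp_comp]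

/-- `J` is unitary, so `(JA)*(JA) = A*A`. -/
theorem sqrtModulus_comp {J : E →L[ℂ] E} (hJ : IsFundamentalSymmetry J) (A : E →L[ℂ] E) :
    sqrtModulus A = CFC.sqrt (CFC.abs (J ∘L A)) := by
  have h : star (J ∘L A) * (J ∘L A) = star A * A := by
    change ContinuousLinearMap.adjoint (J ∘L A) ∘L (J ∘L A) = ContinuousLinearMap.adjoint A ∘L A
    rw [ContinuousLinearMap.adjoint_comp, hJ.1, ContinuousLinearMap.comp_assoc, hJ.comp_comp]
  rw [sqrtModulus, CFC.abs, CFC.abs, h]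

variable {F : Type*} [NormedAddCommGroup F] [InnerProductSpace ℂ F] [CompleteSpace F]

theorem kreinAdjoint_comp_comp (J₂ : F →L[ℂ] F) {J₁ : E →L[ℂ] E} (hJ₁ : IsFundamentalSymmetry J₁)
    (S : F →L[ℂ] E) (L : F →L[ℂ] E) :
    kreinAdjoint J₂ J₁ S ∘L J₁ ∘L L = J₂ ∘L (ContinuousLinearMap.adjoint S ∘L L) := by
  simp only [kreinAdjoint, ContinuousLinearMap.comp_assoc, hJ₁.comp_comp]

theorem negIndex_blockOp {J₁ : E →L[ℂ] E} {J₂ : F →L[ℂ] F} (hJ₁ : IsFundamentalSymmetry J₁)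
    (hJ₂ : IsFundamentalSymmetry J₂) (A₁₁ : E →L[ℂ] E) (A₁₂ : F →L[ℂ] E) (A₂₂ : F →L[ℂ] F) :
    negIndex (sumSymmetry J₁ J₂) (blockOp A₁₁ A₁₂ (kreinAdjoint J₂ J₁ A₁₂) A₂₂) =
      negSquares (fun w => (⟪w, blockOp (J₁ ∘L A₁₁) (J₁ ∘L A₁₂)
        (ContinuousLinearMap.adjoint (J₁ ∘L A₁₂)) (J₂ ∘L A₂₂) w⟫_ℂ).re) := by
  have h : ∀ w, sumSymmetry J₁ J₂ (blockOp A₁₁ A₁₂ (kreinAdjoint J₂ J₁ A₁₂) A₂₂ w) =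
      blockOp (J₁ ∘L A₁₁) (J₁ ∘L A₁₂) (ContinuousLinearMap.adjoint (J₁ ∘L A₁₂)) (J₂ ∘L A₂₂) w := by
    intro w
    simp only [sumSymmetry, blockOp_apply, kreinAdjoint, ContinuousLinearMap.adjoint_comp, hJ₁.1,
      ContinuousLinearMap.comp_apply, map_add, hJ₂.apply_apply, WithLp.toLp_fst, WithLp.toLp_snd,
      zero_apply, add_zero, zero_add]
  simp only [negIndex, form, h]

end Symmetry

end Krein
end

theorem theorem2p1 {H₁ H₂ : Type*}
    [NormedAddCommGroup H₁] [InnerProductSpace ℂ H₁] [CompleteSpace H₁]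
    [NormedAddCommGroup H₂] [InnerProductSpace ℂ H₂] [CompleteSpace H₂]
    (J₁ : H₁ →L[ℂ] H₁) (J₂ : H₂ →L[ℂ] H₂)
    (hJ₁ : Krein.IsFundamentalSymmetry J₁) (hJ₂ : Krein.IsFundamentalSymmetry J₂)
    (A₁₁ : H₁ →L[ℂ] H₁) (A₁₂ : H₂ →L[ℂ] H₁) (A₂₁ : H₁ →L[ℂ] H₂)
    (hA₁₁ : Krein.IsKreinSelfAdjoint J₁ A₁₁)
    (hA₂₁ : A₂₁ = Krein.kreinAdjoint J₂ J₁ A₁₂)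
    (κ : ℕ) (hκ : Krein.negIndex J₁ A₁₁ = (κ : ℕ∞)) :
    -- (i) solvability criterion
    ((∃ A : WithLp 2 (H₁ × H₂) →L[ℂ] WithLp 2 (H₁ × H₂), ∃ A₂₂ : H₂ →L[ℂ] H₂,
        Krein.IsKreinSelfAdjoint J₂ A₂₂ ∧ A = Krein.blockOp A₁₁ A₁₂ A₂₁ A₂₂ ∧
        Krein.negIndex (Krein.sumSymmetry J₁ J₂) A = Krein.negIndex J₁ A₁₁ ∧
        Krein.negIndex J₁ A₁₁ = (κ : ℕ∞)) ↔
      Set.range (J₁ ∘L A₁₂) ⊆ Set.range (Krein.sqrtModulus A₁₁)) ∧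
    -- (ii) smallest solution and description of all solutions
    (Set.range (J₁ ∘L A₁₂) ⊆ Set.range (Krein.sqrtModulus A₁₁) →
      ∃ S : H₂ →L[ℂ] H₁,
        -- `S` is the (everywhere defined, bounded) operator `|A₁₁|^[-1/2] J₁ A₁₂`
        (∀ g : H₂, ∃ hg : J₁ (A₁₂ g) ∈ (Krein.moorePenrose (Krein.sqrtModulus A₁₁)).domain,
          S g = Krein.moorePenrose (Krein.sqrtModulus A₁₁) ⟨J₁ (A₁₂ g), hg⟩) ∧
        -- `S^[*] J₁ J₁₁ S` is a solution, and the smallest one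
        (Krein.kreinAdjoint J₂ J₁ S ∘L J₁ ∘L Krein.signOp (J₁ ∘L A₁₁) ∘L S ∈
            Krein.solutionSet J₁ J₂ A₁₁ A₁₂ A₂₁ κ ∧
          ∀ A₂₂ ∈ Krein.solutionSet J₁ J₂ A₁₁ A₁₂ A₂₁ κ,
            Krein.KreinLE J₂
              (Krein.kreinAdjoint J₂ J₁ S ∘L J₁ ∘L Krein.signOp (J₁ ∘L A₁₁) ∘L S) A₂₂) ∧
        -- all solutions
        Krein.solutionSet J₁ J₂ A₁₁ A₁₂ A₂₁ κ =
          {A₂₂ : H₂ →L[ℂ] H₂ | ∃ Y : H₂ →L[ℂ] H₂, Y.IsPositive ∧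
            A₂₂ = J₂ ∘L (ContinuousLinearMap.adjoint S ∘L Krein.signOp (J₁ ∘L A₁₁) ∘L S + Y) ∧
            A₂₂ = Krein.kreinAdjoint J₂ J₁ S ∘L J₁ ∘L Krein.signOp (J₁ ∘L A₁₁) ∘L S +
              J₂ ∘L Y}) := by
  have hT : IsSelfAdjoint (J₁ ∘L A₁₁) := (Krein.isKreinSelfAdjoint_iff hJ₁ A₁₁).mp hA₁₁
  have hfac := Krein.isSignFactorization hT
  rw [← Krein.sqrtModulus_comp hJ₁] at hfac
  have hκ' : Krein.negSquares (fun f => (inner ℂ f ((J₁ ∘L A₁₁) f)).re) = (κ : ℕ∞) := hκ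
  have hfin := Krein.finiteDimensional_of_negSquares_eq hκ' _
    (fun f hf hf0 => hfac.re_inner_neg hf hf0)
  have hrank := hfac.negSquares_eq.symm.trans hκ'
  have hneg := Krein.negIndex_blockOp hJ₁ hJ₂ A₁₁ A₁₂
  rw [← hA₂₁] at hneg
  have hsymm : ∀ A₂₂, Krein.IsKreinSelfAdjoint J₂ A₂₂ →
      ∀ x y, inner ℂ ((J₂ ∘L A₂₂) x) y = inner ℂ x ((J₂ ∘L A₂₂) y) := fun A₂₂ h x y =>
    ContinuousLinearMap.isSelfAdjoint_iff_isSymmetric.mp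
      ((Krein.isKreinSelfAdjoint_iff hJ₂ A₂₂).mp h) x y
  set R := Krein.sqrtModulus A₁₁
  set σ := Krein.signOp (J₁ ∘L A₁₁)
  have hσsa : IsSelfAdjoint σ :=
    ContinuousLinearMap.isSelfAdjoint_iff_isSymmetric.mpr fun x y => hfac.symm_sign x y
  have main : Set.range (J₁ ∘L A₁₂) ⊆ Set.range R → ∃ S : H₂ →L[ℂ] H₁,
      (∀ g : H₂, ∃ hg : J₁ (A₁₂ g) ∈ (Krein.moorePenrose R).domain,
        S g = Krein.moorePenrose R ⟨J₁ (A₁₂ g), hg⟩) ∧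
      Krein.solutionSet J₁ J₂ A₁₁ A₁₂ A₂₁ κ =
        {A₂₂ | ∃ Y : H₂ →L[ℂ] H₂, Y.IsPositive ∧
          A₂₂ = J₂ ∘L (ContinuousLinearMap.adjoint S ∘L σ ∘L S + Y)} := by
    intro hran
    obtain ⟨S, hS₁, hS₂, hS₃⟩ := Krein.exists_moorePenrose_comp R (J₁ ∘L A₁₂) hran
    refine ⟨S, hS₁, ?_⟩
    have hSσ : IsSelfAdjoint (ContinuousLinearMap.adjoint S ∘L σ ∘L S) := hσsa.adjoint_conj S
    ext A₂₂
    refine ⟨fun ⟨hsa, hind⟩ => ?_, ?_⟩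
    -- `Y` is forced: it is the Schur complement left after completing the square.
    · refine ⟨J₂ ∘L A₂₂ - ContinuousLinearMap.adjoint S ∘L σ ∘L S, ?_, ?_⟩
      · refine ContinuousLinearMap.isPositive_def'.mpr
          ⟨((Krein.isKreinSelfAdjoint_iff hJ₂ A₂₂).mp hsa).sub hSσ, fun g => ?_⟩
        rw [hneg, ← hrank] at hind
        have := hfac.re_inner_nonneg_of_negSquares_le
          (Y := J₂ ∘L A₂₂ - ContinuousLinearMap.adjoint S ∘L σ ∘L S) hS₂ hS₃ (hsymm A₂₂ hsa)
          (fun g => by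
            simp [ContinuousLinearMap.adjoint_inner_right]) hind.le g
        rw [ContinuousLinearMap.reApplyInnerSelf_apply, inner_re_symm]
        exact this
      · rw [add_sub_cancel, hJ₂.comp_comp]
    · rintro ⟨Y, hY, rfl⟩
      refine ⟨?_, ?_⟩
      · rw [Krein.isKreinSelfAdjoint_iff hJ₂, hJ₂.comp_comp]
        exact hSσ.add hY.isSelfAdjoint
      · rw [hneg, hJ₂.comp_comp, ← hrank]
        exact hfac.negSquares_blockOp_eq (Y := Y) hS₂
          (fun g => by
            simp [ContinuousLinearMap.adjoint_inner_right])
          (fun g => hY.re_inner_nonneg_right g)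
  refine ⟨⟨?_, fun hran => ?_⟩, fun hran => ?_⟩
  · rintro ⟨_, A₂₂, hsa, rfl, hind, -⟩
    rw [hκ, hneg, ← hrank] at hind
    exact hfac.range_subset (hsymm A₂₂ hsa) hind.le
  · obtain ⟨S, -, hS⟩ := main hran
    have hmem : J₂ ∘L (ContinuousLinearMap.adjoint S ∘L σ ∘L S + 0) ∈
        Krein.solutionSet J₁ J₂ A₁₁ A₁₂ A₂₁ κ := by
      rw [hS]
      exact ⟨0, ContinuousLinearMap.isPositive_zero, rfl⟩
    exact ⟨_, _, hmem.1, rfl, hmem.2.trans hκ.symm, hκ⟩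
  · obtain ⟨S, hS₁, hS⟩ := main hran
    refine ⟨S, hS₁, ?_⟩
    rw [Krein.kreinAdjoint_comp_comp J₂ hJ₁, hS]
    refine ⟨⟨⟨0, ContinuousLinearMap.isPositive_zero, by rw [add_zero]⟩, ?_⟩, ?_⟩
    · rintro _ ⟨Y, hY, rfl⟩ f
      rw [ContinuousLinearMap.comp_add, add_sub_cancel_left, Krein.form,
        ContinuousLinearMap.comp_apply, hJ₂.apply_apply]
      exact hY.re_inner_nonneg_right f
    · ext A₂₂
      refine exists_congr fun Y => and_congr_right fun _ => ?_
      rw [← ContinuousLinearMap.comp_add, and_self]
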